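/- A piece is an axis-parallel rectangle of size $w\times h$. Given a non-empty stream (finite sequence) of pieces, one has to place them in the plane without overlapping (interiors disjoint), where each piece may be translated and rotated by $90^\circ$. The cost is the area of the axis-parallel bounding box of the placed pieces. For a stream $L$ let $\mathrm{Opt}=\mathrm{Opt}(L)$ be the infimum of the cost over all packings of $L$, and let $n=|L|$ be the number of pieces. An online algorithm places each piece irrevocably, before it knows the later ones. The algorithm $\mathrm{DynBoxRot}_{\sqrt n\wedge\sqrt[4]{\mathrm{Opt}}}$ works as follows. Each arriving piece $p_j$ is first rotated so that its size $w_j\times h_j$ satisfies $w_j\le h_j$. Let $H_j=\max_{i\le j}h_i$, let $\Sigma_j=\sum_{i\le j}w_ih_i$, let $$\widetilde T_j=\begin{cases}\Sigma_j^{3/4}+7H_j,&\text{if }\Sigma_j<j^2,\\ H_j\sqrt j+7H_j,&\text{otherwise,}\end{cases}\qquad T_0=0,\qquad T_j=\max\{T_{j-1},\widetilde T_j\}\quad(j\ge1).$$ For $k\in\mathbb Z$, the box $B_k$ is $[2^k,2^{k+1}]\times[0,T_j]$ after the arrival of $p_j$. Pieces are packed into $B_k$ by the next-fit shelf algorithm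 $\mathrm{NFS}_k$ on the strip of width $2^k$: the strip is filled from bottom to top by shelves, each of width $2^k$ and of some height $2^m$, $m\in\mathbb Z$. A shelf is sparse if the total width of its pieces is at most $2^{k-1}$. A piece of height $h$ with $2^{m-1}<h\le2^m$ is placed as far left as possible into the sparse shelf of height $2^m$ (there is at most one). If there is no such shelf, or if it has no room for the piece, the piece is placed at the left end of a new shelf of height $2^m$ on top of all shelves. The first piece is packed into $B_k$ with $2^{k-1}<w_1\le2^k$, and $B_k$ becomes the active box. When a later piece $p_j$ arrives and $B_i$ is active, then: - if $w_j>2^i$, the piece $p_j$ is packed into $B_\ell$ with $2^{\ell-1}<w_j\le2^\ell$, and $B_\ell$ becomes active; - otherwise, if $\mathrm{NFS}_i$ would place $p_j$ in $B_i$ so that its top edge is above height $T_j$, the piece $p_j$ is packed into $B_{i+1}$ instead, and $B_{i+1}$ becomes active; - otherwise $p_j$ is packed into $B_i$. **Theorem.** On streams of pieces all of whose edges have length at least $1$, this is an online algorithm that always produces a packing, and it has absolute competitive ratio $O(\min\{\sqrt n,\sqrt[4]{\mathrm{Opt}}\})$ for the area problem with rotations. That is, there is an absolute constant $C>0$ such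 that for every non-empty stream $L$ of $n$ pieces with all edges of length at least $1$, the area $A(L)$ of the bounding box of the packing produced by the algorithm satisfies $$A(L)\le C\cdot\min\{\sqrt n,\sqrt[4]{\mathrm{Opt}(L)}\}\cdot\mathrm{Opt}(L).$$ -/

import Mathlib

noncomputable section

namespace OnlinePacking

/-! ### Pieces, packings, cost, optimum -/

/-- A rectangular piece of size `w × h`. -/
structure Piece where
  w : ℝ
  h : ℝ
  w_pos : 0 < w
  h_pos : 0 < h

/-- The piece `p` rotated by 90 degrees if needed, so that its width is at most its height. -/
def Piece.upright (p : Piece) : Piece :=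
  if p.w ≤ p.h then p else ⟨p.h, p.w, p.h_pos, p.w_pos⟩

/-- An axis-parallel rectangle of size `w × h` in the plane with lower left corner `(x, y)`. -/
structure Rect where
  x : ℝ
  y : ℝ
  w : ℝ
  h : ℝ

/-- The open rectangle. -/
def Rect.inner (R : Rect) : Set (ℝ × ℝ) :=
  Set.Ioo R.x (R.x + R.w) ×ˢ Set.Ioo R.y (R.y + R.h)

/-- `R` is a translate of `p`, or of `p` rotated by 90 degrees. -/
def IsPlacementOf (p : Piece) (R : Rect) : Prop :=
  (R.w = p.w ∧ R.h = p.h) ∨ (R.w = p.h ∧ R.h = p.w)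

/-- `P` is a packing of the stream `L`, rotations allowed: the `i`-th rectangle of `P` is a
placement of the `i`-th piece of `L`, and the rectangles do not overlap. -/
def IsPacking (L : List Piece) (P : List Rect) : Prop :=
  List.Forall₂ IsPlacementOf L P ∧ P.Pairwise (fun R S => Disjoint R.inner S.inner)

/-- The area of the axis-parallel bounding box of a (non-empty) list of rectangles. -/
def boundingBoxArea (P : List Rect) : ℝ :=
  (sSup {a | ∃ R ∈ P, a = R.x + R.w} - sInf {a | ∃ R ∈ P, a = R.x}) *
    (sSup {b | ∃ R ∈ P, b = R.y + R.h} - sInf {b | ∃ R ∈ P, b = R.y})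

/-- The least area of the bounding box of an offline packing of `L`, rotations allowed. -/
def opt (L : List Piece) : ℝ :=
  sInf {A | ∃ P : List Rect, IsPacking L P ∧ A = boundingBoxArea P}

/-- The non-empty streams all of whose edges have length at least `1`. -/
def longStreams : Set (List Piece) :=
  {L | L ≠ [] ∧ ∀ p ∈ L, 1 ≤ p.w ∧ 1 ≤ p.h}

/-- `A` is an online packing algorithm (rotations allowed) on the class `𝓛` of streams: it outputs
a packing of every stream of the class, and the rectangles placed for a stream are left in
place, and in order, when more pieces arrive. -/
def IsOnlineAlgorithm (𝓛 : Set (List Piece)) (A : List Piece → List Rect) : Prop :=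
  (∀ L ∈ 𝓛, IsPacking L (A L)) ∧ ∀ L L' : List Piece, A L <+: A (L ++ L')

/-- `A` has absolute competitive ratio `f` on the class `𝓛`, for the area of the bounding box with
rotations allowed: the quotient of `A(L)` by `f(L) · Opt(L)` is at most `1` for all `L ∈ 𝓛`. -/
def HasAbsoluteCompetitiveRatio (𝓛 : Set (List Piece)) (A : List Piece → List Rect)
    (f : List Piece → ℝ) : Prop :=
  ∀ L ∈ 𝓛, boundingBoxArea (A L) ≤ f L * opt L

/-! ### The next-fit shelf algorithm in a box -/

/-- The integer `k` with `2 ^ (k - 1) < r ≤ 2 ^ k`, for `r > 0`. -/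
def level (r : ℝ) : ℤ := Int.clog 2 r

theorem le_two_zpow_level (r : ℝ) : r ≤ (2 : ℝ) ^ level r := by
  have := Int.self_le_zpow_clog (b := 2) (by norm_num) r
  simpa [level] using this

theorem two_zpow_level_sub_one_lt {r : ℝ} (hr : 0 < r) : (2 : ℝ) ^ (level r - 1) < r := by
  have := Int.zpow_pred_clog_lt_self (b := 2) (by norm_num) hr
  simpa [level] using this

/-- A shelf of height `2 ^ lev` in which pieces of total width `used` have been packed. -/
structure Shelf where
  lev : ℤ
  used : ℝ

/-- Packs `p` by the next-fit shelf algorithm into a strip of width `2 ^ k` whose current shelves,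
listed from bottom to top, stand on top of each other starting at height `y`. The result is the
new list of shelves, with the coordinates of the lower left corner of `p` relative to the left
edge of the strip. The piece goes, as far left as possible, into a shelf of height
`2 ^ level p.h` that is sparse (total width at most `2 ^ (k - 1)`) and has room for it, and if
there is none, into a new shelf of that height on top of all others. (There is never more than
one sparse shelf of a given height.) -/
def nfs (k : ℤ) (p : Piece) (y : ℝ) : List Shelf → List Shelf × (ℝ × ℝ)
  | [] => ([⟨level p.h, p.w⟩], (0, y))
  | s :: rest =>
    if s.lev = level p.h ∧ s.used ≤ 2 ^ (k - 1) ∧ s.used + p.w ≤ 2 ^ k then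
      (⟨s.lev, s.used + p.w⟩ :: rest, (s.used, y))
    else
      let r := nfs k p (y + 2 ^ s.lev) rest
      (s :: r.1, r.2)

/-! ### The dynamic box scheme -/

/-- The state of the scheme: the pieces seen so far (in order), the index of the active box (if a
piece has arrived), the shelves of each box from bottom to top, and the rectangles placed. -/
structure State where
  seen : List Piece
  active : Option ℤ
  shelves : ℤ → List Shelf
  placed : List Rect

def State.init : State := ⟨[], none, fun _ => [], []⟩

/-- The box into which `p` is packed, if the threshold is `t` after the arrival of `p`. If the
active box `i` is not wide enough, this is the box `level p.w`; if the next-fit shelf algorithm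
would place `p` so that it sticks out of the active box, of size `2 ^ i × t`, this is the box
`i + 1`; otherwise it is the active box. -/
def State.target (s : State) (t : ℝ) (p : Piece) : ℤ :=
  match s.active with
  | none => level p.w
  | some i =>
    if (2 : ℝ) ^ i < p.w then level p.w
    else if t < (nfs i p 0 (s.shelves i)).2.2 + p.h then i + 1
    else i

/-- One step of the scheme for the threshold function `T` (a function of the pieces seen so far,
the current one included). The box `k` occupies the horizontal range from `2 ^ k` to `2 ^ (k + 1)`
and has its bottom edge on the horizontal axis. -/
def State.step (T : List Piece → ℝ) (s : State) (p : Piece) : State :=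
  let k := s.target (T (s.seen ++ [p])) p
  let r := nfs k p 0 (s.shelves k)
  { seen := s.seen ++ [p]
    active := some k
    shelves := Function.update s.shelves k r.1
    placed := s.placed ++ [⟨2 ^ k + r.2.1, r.2.2, p.w, p.h⟩] }

/-- The scheme without rotations. -/
def dynBox (T : List Piece → ℝ) (L : List Piece) : List Rect :=
  (L.foldl (State.step T) State.init).placed

/-- The scheme with rotations: every piece is first rotated so that its width is at most its
height. -/
def dynBoxRot (T : List Piece → ℝ) (L : List Piece) : List Rect :=
  dynBox T (L.map Piece.upright)

/-! ### The threshold -/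

/-- The total area of the pieces. -/
def totalArea (L : List Piece) : ℝ := (L.map fun p => p.w * p.h).sum

/-- The maximal height of a piece (`0` if there is none). -/
def maxHeight (L : List Piece) : ℝ := (L.map Piece.h).foldr max 0

/-- The preliminary threshold after the pieces of `L`, with `j = L.length`. -/
def preThreshold (L : List Piece) : ℝ :=
  if totalArea L < (L.length : ℝ) ^ 2 then
    totalArea L ^ (3 / 4 : ℝ) + 7 * maxHeight L
  else
    maxHeight L * Real.sqrt L.length + 7 * maxHeight L

/-- The monotone threshold `T_j` after the first `j` pieces of `L`. -/
def threshold (L : List Piece) : ℕ → ℝ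
  | 0 => 0
  | j + 1 => max (threshold L j) (preThreshold (L.take (j + 1)))

/-- The dynamic box algorithm with rotations for the threshold above. -/
def dynBoxRotMin : List Piece → List Rect :=
  dynBoxRot fun L => threshold L L.length

end OnlinePacking

end

noncomputable section

namespace OnlinePacking

/-! ### Shelves -/

/-! Write Σ for the total area, H for the maximal height, O for the optimum and μ for min(√n,
O^(1/4)). Lower bounds on O: Σ ≤ O by measure, and w·H ≤ O for every upright width w, since both
sides of any bounding box are at least w and one is at least H
(`width_mul_height_le_boundingBoxArea`). In particular w² ≤ O, and H ≤ O because w ≥ 1.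

Shelf packing wastes little (`ShelvesOK.height_le`): shelves of a strip of width b have total height
at most 4Σ/b + 4H. Non-sparse shelves are at least a quarter full, and the sparse ones have distinct
powers of two as heights.

Boxes up to the active index k end at x = 2^(k+1), so the cost is at most 2^(k+1) times the largest
height reached. The invariant `BoxJustified` records why box k is in use.

Wide piece, 2^k < 2w: the cost is at most 4wT, and w·T = O(μO) for both branches of the threshold,
using w ≤ √O for the term Σ^(3/4) and wH ≤ O for the term H√j.

Overflow of box k-1, of width b, after a prefix with data Σ', H', j, T': the shelf bound gives T'b <
4Σ' + 5H'b. Everything outside box k lies below T', and box k obeys its own shelf bound, so all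
heights are at most 4Σ/b + 5H and the cost is at most 16Σ + 20bH. The same inequality bounds b: the
first branch gives b < 4Σ'^(1/4), the second gives b ≤ 4√j·w for some w, as Σ' ≤ jwH'. Hence bH =
O(μO).

The test Σ < j² compares Σ^(1/4) with √j, so the quantity used in either branch is the smaller one
and is at most μ. -/

/-- The total height of a list of shelves. -/
def shelvesHeight (ss : List Shelf) : ℝ := (ss.map fun s => (2 : ℝ) ^ s.lev).sum

/-- A lower bound on the total area of the pieces in a list of shelves. -/
def shelvesArea (ss : List Shelf) : ℝ := (ss.map fun s => s.used * (2 : ℝ) ^ (s.lev - 1)).sum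

/-- `R` stands on the bottom of one of the shelves `ss`, which start at height `y` and have their
left edge at `X`, and lies within the used part of the shelf. -/
def InShelves (X : ℝ) (R : Rect) : ℝ → List Shelf → Prop
  | _, [] => False
  | y, s :: rest =>
    (R.y = y ∧ R.h ≤ 2 ^ s.lev ∧ X ≤ R.x ∧ R.x + R.w ≤ X + s.used) ∨
      InShelves X R (y + 2 ^ s.lev) rest

/-- The shelves `ss` of a strip of width `2 ^ k` are filled within their width, and no two sparse
ones have the same height. -/
structure ShelvesOK (k : ℤ) (ss : List Shelf) : Prop where
  used_nonneg : ∀ s ∈ ss, 0 ≤ s.used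
  used_le : ∀ s ∈ ss, s.used ≤ 2 ^ k
  sparse : ss.Pairwise fun s t =>
    s.lev = t.lev → s.used ≤ 2 ^ (k - 1) → ¬ t.used ≤ 2 ^ (k - 1)

theorem two_zpow_sub_one (k : ℤ) : (2 : ℝ) ^ (k - 1) = 2 ^ k / 2 := by
  rw [zpow_sub_one₀ (by norm_num)]; ring

theorem two_zpow_pos (k : ℤ) : (0 : ℝ) < 2 ^ k := by positivity

theorem shelvesHeight_nonneg (ss : List Shelf) : 0 ≤ shelvesHeight ss := by
  unfold shelvesHeight
  apply List.sum_nonneg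
  simp only [List.mem_map]
  rintro _ ⟨s, -, rfl⟩
  positivity

theorem InShelves.le_y {X : ℝ} {R : Rect} {ss : List Shelf} :
    ∀ {y : ℝ}, InShelves X R y ss → y ≤ R.y := by
  induction ss with
  | nil => intro y h; exact h.elim
  | cons s rest ih =>
    intro y h
    rcases h with h | h
    · exact h.1.ge
    · have := ih h
      have := two_zpow_pos s.lev
      linarith

theorem InShelves.top_le {X : ℝ} {R : Rect} {ss : List Shelf} :
    ∀ {y : ℝ}, InShelves X R y ss → R.y + R.h ≤ y + shelvesHeight ss := by
  induction ss with
  | nil => intro y h; exact h.elim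
  | cons s rest ih =>
    intro y h
    have h0 := shelvesHeight_nonneg rest
    have h1 : shelvesHeight (s :: rest) = 2 ^ s.lev + shelvesHeight rest := by
      simp [shelvesHeight]
    rcases h with h | h
    · linarith [h.1, h.2.1]
    · linarith [ih h]

theorem InShelves.left_le {X : ℝ} {R : Rect} {ss : List Shelf} :
    ∀ {y : ℝ}, InShelves X R y ss → X ≤ R.x := by
  induction ss with
  | nil => intro y h; exact h.elim
  | cons s rest ih =>
    intro y h
    rcases h with h | h
    · exact h.2.2.1
    · exact ih h

theorem InShelves.right_le {X c : ℝ} {R : Rect} {ss : List Shelf} (hc : ∀ s ∈ ss, s.used ≤ c) :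
    ∀ {y : ℝ}, InShelves X R y ss → R.x + R.w ≤ X + c := by
  induction ss with
  | nil => intro y h; exact h.elim
  | cons s rest ih =>
    intro y h
    rcases h with h | h
    · linarith [h.2.2.2, hc s (by simp)]
    · exact ih (fun t ht => hc t (by simp [ht])) h

theorem disjoint_inner_of_right_le {R S : Rect} (h : R.x + R.w ≤ S.x) :
    Disjoint R.inner S.inner := by
  rw [Set.disjoint_left]
  rintro ⟨a, b⟩ ⟨h1, -⟩ ⟨h2, -⟩
  simp only [Set.mem_Ioo] at h1 h2
  linarith [h1.2, h2.1]

theorem disjoint_inner_of_top_le {R S : Rect} (h : R.y + R.h ≤ S.y) :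
    Disjoint R.inner S.inner := by
  rw [Set.disjoint_left]
  rintro ⟨a, b⟩ ⟨-, h1⟩ ⟨-, h2⟩
  simp only [Set.mem_Ioo] at h1 h2
  linarith [h1.2, h2.1]

/-! ### One step of the next-fit shelf algorithm -/

section NextFit

variable {k : ℤ} {p : Piece}

theorem nfs_y_le (ss : List Shelf) : ∀ y : ℝ, (nfs k p y ss).2.2 ≤ y + shelvesHeight ss := by
  induction ss with
  | nil => intro y; simp [nfs, shelvesHeight]
  | cons s rest ih =>
    intro y
    have h0 := shelvesHeight_nonneg rest
    have h1 : shelvesHeight (s :: rest) = 2 ^ s.lev + shelvesHeight rest := by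
      simp [shelvesHeight]
    have := two_zpow_pos s.lev
    rw [nfs]
    split_ifs
    · simp only; linarith
    · simp only; linarith [ih (y + 2 ^ s.lev)]

theorem le_nfs_y (ss : List Shelf) : ∀ y : ℝ, y ≤ (nfs k p y ss).2.2 := by
  induction ss with
  | nil => intro y; simp [nfs]
  | cons s rest ih =>
    intro y
    have := two_zpow_pos s.lev
    rw [nfs]
    split_ifs
    · simp
    · simp only; linarith [ih (y + 2 ^ s.lev)]

theorem inShelves_nfs_self {X : ℝ} (ss : List Shelf) (hs : ∀ s ∈ ss, 0 ≤ s.used) : ∀ y : ℝ,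
    InShelves X ⟨X + (nfs k p y ss).2.1, (nfs k p y ss).2.2, p.w, p.h⟩ y (nfs k p y ss).1 := by
  induction ss with
  | nil =>
    intro y
    exact Or.inl ⟨rfl, le_two_zpow_level _, by simp [nfs], by simp [nfs]⟩
  | cons s rest ih =>
    intro y
    rw [nfs]
    split_ifs with h
    · refine Or.inl ⟨rfl, ?_, ?_, ?_⟩
      · simp only [h.1]; exact le_two_zpow_level _
      · simpa using hs s (by simp)
      · simp only; linarith
    · exact Or.inr (ih (fun t ht => hs t (by simp [ht])) _)

theorem InShelves.nfs {X : ℝ} {R : Rect} {ss : List Shelf} :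
    ∀ {y : ℝ}, InShelves X R y ss → InShelves X R y (nfs k p y ss).1 := by
  induction ss with
  | nil => intro y h; exact h.elim
  | cons s rest ih =>
    intro y h
    rw [OnlinePacking.nfs]
    split_ifs
    · rcases h with h | h
      · have := p.w_pos
        refine Or.inl ⟨h.1, h.2.1, h.2.2.1, ?_⟩
        simp only; linarith [h.2.2.2]
      · exact Or.inr h
    · rcases h with h | h
      · exact Or.inl h
      · exact Or.inr (ih h)

/-- Within the shelf that receives `p`, older pieces end where `p` begins; in different shelves the
two are separated by a shelf boundary, as no piece is taller than its shelf. -/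
theorem InShelves.disjoint_nfs {X : ℝ} {R : Rect} {ss : List Shelf} :
    ∀ {y : ℝ}, InShelves X R y ss →
      Disjoint R.inner
        (Rect.inner ⟨X + (OnlinePacking.nfs k p y ss).2.1, (OnlinePacking.nfs k p y ss).2.2,
          p.w, p.h⟩) := by
  induction ss with
  | nil => intro y h; exact h.elim
  | cons s rest ih =>
    intro y h
    rw [OnlinePacking.nfs]
    split_ifs with hs
    · rcases h with h | h
      · exact disjoint_inner_of_right_le h.2.2.2
      · refine (disjoint_inner_of_top_le ?_).symm
        have h1 := le_two_zpow_level p.h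
        have h2 := h.le_y
        rw [hs.1] at h2
        simp only; linarith
    · rcases h with h | h
      · refine disjoint_inner_of_top_le ?_
        simp only
        have := le_nfs_y (k := k) (p := p) rest (y + 2 ^ s.lev)
        linarith [h.1, h.2.1]
      · exact ih h

/-- A piece is taller than half its shelf, so the area credited to the shelf is at most the true
area of the piece. -/
theorem shelvesArea_nfs_le (ss : List Shelf) : ∀ y : ℝ,
    shelvesArea (nfs k p y ss).1 ≤ shelvesArea ss + p.w * p.h := by
  have key : p.w * (2 : ℝ) ^ (level p.h - 1) ≤ p.w * p.h :=
    mul_le_mul_of_nonneg_left (two_zpow_level_sub_one_lt p.h_pos).le p.w_pos.le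
  induction ss with
  | nil => intro y; simpa [nfs, shelvesArea] using key
  | cons s rest ih =>
    intro y
    rw [nfs]
    split_ifs with h
    · rw [← h.1] at key
      simp only [shelvesArea, List.map_cons, List.sum_cons]
      linarith
    · have := ih (y + 2 ^ s.lev)
      simp only [shelvesArea, List.map_cons, List.sum_cons] at this ⊢
      linarith

/-- Every shelf after a step was there before, up to its used width, or it is a new shelf for `p`
which does not duplicate a sparse shelf. -/
theorem mem_nfs (ss : List Shelf) : ∀ (y : ℝ), ∀ t ∈ (nfs k p y ss).1,
    (t = ⟨level p.h, p.w⟩ ∧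
      ∀ s ∈ ss, ¬ (s.lev = level p.h ∧ s.used ≤ 2 ^ (k - 1) ∧ s.used + p.w ≤ 2 ^ k)) ∨
    ∃ s ∈ ss, s.lev = t.lev ∧ s.used ≤ t.used ∧ (t.used = s.used ∨
      (t.used = s.used + p.w ∧ s.used + p.w ≤ 2 ^ k)) := by
  induction ss with
  | nil => intro y t ht; left; simpa [nfs] using ht
  | cons s rest ih =>
    intro y t ht
    rw [nfs] at ht
    split_ifs at ht with h
    · right
      rcases List.mem_cons.1 ht with rfl | ht
      · exact ⟨s, by simp, rfl, by simp [p.w_pos.le], Or.inr ⟨rfl, h.2.2⟩⟩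
      · exact ⟨t, by simp [ht], rfl, le_rfl, Or.inl rfl⟩
    · rcases List.mem_cons.1 ht with rfl | ht
      · exact Or.inr ⟨t, by simp, rfl, le_rfl, Or.inl rfl⟩
      · rcases ih _ t ht with ⟨h1, h2⟩ | ⟨u, hu, h2⟩
        · refine Or.inl ⟨h1, ?_⟩
          intro u hu
          rcases List.mem_cons.1 hu with rfl | hu
          · exact h
          · exact h2 u hu
        · exact Or.inr ⟨u, by simp [hu], h2⟩

/-- A second sparse shelf of one height cannot arise: if the old shelf and a new one holding only
`p` are both at most half full, then `p` fits into the old one. -/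
theorem ShelvesOK.nfs {ss : List Shelf} (hss : ShelvesOK k ss) (hp : p.w ≤ 2 ^ k) :
    ∀ y : ℝ, ShelvesOK k (nfs k p y ss).1 := by
  intro y
  refine ⟨?_, ?_, ?_⟩
  · intro t ht
    rcases mem_nfs ss y t ht with ⟨rfl, -⟩ | ⟨s, hs, -, h, -⟩
    · exact p.w_pos.le
    · exact (hss.used_nonneg s hs).trans h
  · intro t ht
    rcases mem_nfs ss y t ht with ⟨rfl, -⟩ | ⟨s, hs, -, -, h | h⟩
    · exact hp
    · rw [h]; exact hss.used_le s hs
    · rw [h.1]; exact h.2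
  · have hsp := hss.sparse
    have hk := two_zpow_sub_one k
    clear hss
    induction ss generalizing y with
    | nil => simp [OnlinePacking.nfs]
    | cons s rest ih =>
      rw [List.pairwise_cons] at hsp
      rw [OnlinePacking.nfs]
      split_ifs with h
      · refine List.pairwise_cons.2 ⟨fun t ht h1 h2 => hsp.1 t ht h1 ?_, hsp.2⟩
        have := p.w_pos
        simp only at h2
        linarith
      · refine List.pairwise_cons.2 ⟨fun t ht h1 h2 h3 => ?_, ih _ hsp.2⟩
        rcases mem_nfs rest _ t ht with ⟨rfl, -⟩ | ⟨u, hu, h4, h5, -⟩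
        · exact h ⟨h1, h2, by simp only at h3; linarith⟩
        · exact hsp.1 u hu (h1.trans h4.symm) h2 (h5.trans h3)

/-! ### The height of the shelves -/

/-- Distinct powers of two sum to at most twice the largest, which itself is at most 2H. -/
theorem sum_two_zpow_le {F : Finset ℤ} {H : ℝ} (hH : 0 ≤ H)
    (hF : ∀ m ∈ F, (2 : ℝ) ^ (m - 1) ≤ H) : ∑ m ∈ F, (2 : ℝ) ^ m ≤ 4 * H := by
  have key : ∀ F : Finset ℤ, ∀ M : ℤ, (∀ m ∈ F, m ≤ M) → ∑ m ∈ F, (2 : ℝ) ^ m ≤ 2 ^ (M + 1) := by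
    intro F
    induction F using Finset.induction_on_max with
    | empty => intro M _; simpa using (two_zpow_pos (M + 1)).le
    | insert a F ha ih =>
      intro M hM
      rw [Finset.sum_insert (fun h => lt_irrefl _ (ha a h))]
      have h1 := ih (a - 1) (fun m hm => by have := ha m hm; omega)
      have h2 : (2 : ℝ) ^ (a + 1) ≤ 2 ^ (M + 1) :=
        zpow_le_zpow_right₀ (by norm_num) (by have := hM a (by simp); omega)
      rw [sub_add_cancel] at h1
      rw [zpow_add_one₀ (by norm_num)] at h2
      linarith
  rcases F.eq_empty_or_nonempty with rfl | hne
  · simpa using hH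
  · have h1 := key F (F.max' hne) (fun m hm => F.le_max' m hm)
    have h2 := hF _ (F.max'_mem hne)
    rw [two_zpow_sub_one] at h2
    rw [zpow_add_one₀ (by norm_num)] at h1
    linarith

theorem ShelvesOK.height_le {ss : List Shelf} (hss : ShelvesOK k ss) {H : ℝ} (hH : 0 ≤ H)
    (hlev : ∀ s ∈ ss, (2 : ℝ) ^ (s.lev - 1) ≤ H) :
    shelvesHeight ss * 2 ^ k ≤ 4 * shelvesArea ss + 4 * H * 2 ^ k := by
  -- `F` collects the levels of the sparse shelves. Each level occurs once, so these shelves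
  -- contribute a sum of distinct powers of two; every other shelf is paid for by 4 times its
  -- credited area.
  obtain ⟨F, hF, hle⟩ : ∃ F : Finset ℤ,
      (∀ m ∈ F, ∃ s ∈ ss, s.lev = m ∧ s.used ≤ 2 ^ (k - 1)) ∧
      shelvesHeight ss * 2 ^ k ≤ 4 * shelvesArea ss + (∑ m ∈ F, (2 : ℝ) ^ m) * 2 ^ k := by
    obtain ⟨h0, -, hsp⟩ := hss
    clear hlev
    induction ss with
    | nil => exact ⟨∅, by simp, by simp [shelvesHeight, shelvesArea]⟩
    | cons s rest ih =>
      rw [List.pairwise_cons] at hsp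
      obtain ⟨F, hF, hle⟩ := ih (fun t ht => h0 t (by simp [ht])) hsp.2
      have hs := h0 s (by simp)
      have hk := two_zpow_sub_one k
      have hl := two_zpow_sub_one s.lev
      have hp := two_zpow_pos s.lev
      simp only [shelvesHeight, shelvesArea, List.map_cons, List.sum_cons] at hle ⊢
      by_cases hsparse : s.used ≤ 2 ^ (k - 1)
      · have hnot : s.lev ∉ F := by
          intro hmem
          obtain ⟨t, ht, h1, h2⟩ := hF _ hmem
          exact hsp.1 t ht h1.symm hsparse h2
        refine ⟨insert s.lev F, ?_, ?_⟩
        · intro m hm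
          rcases Finset.mem_insert.1 hm with rfl | hm
          · exact ⟨s, by simp, rfl, hsparse⟩
          · obtain ⟨t, ht, h⟩ := hF m hm
            exact ⟨t, by simp [ht], h⟩
        · rw [Finset.sum_insert hnot]
          have : 0 ≤ s.used * 2 ^ (s.lev - 1) := by positivity
          linarith
      · refine ⟨F, fun m hm => ?_, ?_⟩
        · obtain ⟨t, ht, h⟩ := hF m hm
          exact ⟨t, by simp [ht], h⟩
        · have : (2 : ℝ) ^ k / 2 * 2 ^ s.lev ≤ s.used * 2 ^ s.lev := by
            rw [← hk]; exact mul_le_mul_of_nonneg_right (not_le.1 hsparse).le hp.le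
          rw [hl]
          linarith
  have := sum_two_zpow_le hH (F := F) (fun m hm => by
    obtain ⟨s, hs, rfl, -⟩ := hF m hm
    exact hlev s hs)
  have := mul_le_mul_of_nonneg_right this (two_zpow_pos k).le
  linarith

end NextFit

open MeasureTheory

/-! ### Bounding boxes and the optimum -/

theorem finite_setOf_mem_eq (P : List Rect) (f : Rect → ℝ) : {a | ∃ R ∈ P, a = f R}.Finite :=
  (P.finite_toSet.image f).subset (by rintro _ ⟨R, hR, rfl⟩; exact ⟨R, hR, rfl⟩)

theorem boundingBoxArea_le {P : List Rect} (hP : P ≠ []) {a b : ℝ}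
    (hx : ∀ R ∈ P, 0 ≤ R.x) (hw : ∀ R ∈ P, 0 ≤ R.w) (ha : ∀ R ∈ P, R.x + R.w ≤ a)
    (hy : ∀ R ∈ P, 0 ≤ R.y) (hh : ∀ R ∈ P, 0 ≤ R.h) (hb : ∀ R ∈ P, R.y + R.h ≤ b) :
    boundingBoxArea P ≤ a * b := by
  obtain ⟨R₀, hR₀⟩ := List.exists_mem_of_ne_nil P hP
  have h1 : sSup {a | ∃ R ∈ P, a = R.x + R.w} ≤ a :=
    csSup_le ⟨_, R₀, hR₀, rfl⟩ (by rintro _ ⟨R, hR, rfl⟩; exact ha R hR)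
  have h2 : sSup {a | ∃ R ∈ P, a = R.y + R.h} ≤ b :=
    csSup_le ⟨_, R₀, hR₀, rfl⟩ (by rintro _ ⟨R, hR, rfl⟩; exact hb R hR)
  have h3 : 0 ≤ sInf {a | ∃ R ∈ P, a = R.x} :=
    le_csInf ⟨_, R₀, hR₀, rfl⟩ (by rintro _ ⟨R, hR, rfl⟩; exact hx R hR)
  have h4 : 0 ≤ sInf {a | ∃ R ∈ P, a = R.y} :=
    le_csInf ⟨_, R₀, hR₀, rfl⟩ (by rintro _ ⟨R, hR, rfl⟩; exact hy R hR)
  have h5 := le_csSup (finite_setOf_mem_eq P fun R => R.y + R.h).bddAbove ⟨R₀, hR₀, rfl⟩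
  have h6 := csInf_le (finite_setOf_mem_eq P fun R => R.y).bddBelow ⟨R₀, hR₀, rfl⟩
  have h7 := hw R₀ hR₀
  have h8 := hh R₀ hR₀
  have h9 := hx R₀ hR₀
  have h10 := ha R₀ hR₀
  unfold boundingBoxArea
  exact mul_le_mul (by linarith) (by linarith) (by linarith) (by linarith)

/-- The bounding box of a list of rectangles, which all lie in it. -/
theorem exists_boundingBox (P : List Rect) : ∃ x₀ x₁ y₀ y₁ : ℝ,
    boundingBoxArea P = (x₁ - x₀) * (y₁ - y₀) ∧
    ∀ R ∈ P, x₀ ≤ R.x ∧ R.x + R.w ≤ x₁ ∧ y₀ ≤ R.y ∧ R.y + R.h ≤ y₁ :=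
  ⟨_, _, _, _, rfl, fun R hR =>
    ⟨csInf_le (finite_setOf_mem_eq P fun R => R.x).bddBelow ⟨R, hR, rfl⟩,
      le_csSup (finite_setOf_mem_eq P fun R => R.x + R.w).bddAbove ⟨R, hR, rfl⟩,
      csInf_le (finite_setOf_mem_eq P fun R => R.y).bddBelow ⟨R, hR, rfl⟩,
      le_csSup (finite_setOf_mem_eq P fun R => R.y + R.h).bddAbove ⟨R, hR, rfl⟩⟩⟩

theorem IsPlacementOf.pos {p : Piece} {R : Rect} (h : IsPlacementOf p R) : 0 < R.w ∧ 0 < R.h := by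
  have := p.w_pos
  have := p.h_pos
  rcases h with ⟨h1, h2⟩ | ⟨h1, h2⟩ <;> rw [h1, h2] <;> constructor <;> assumption

theorem exists_placement {L : List Piece} {P : List Rect} (h : List.Forall₂ IsPlacementOf L P)
    {p : Piece} (hp : p ∈ L) : ∃ R ∈ P, IsPlacementOf p R := by
  induction h with
  | nil => simp at hp
  | cons h _ ih =>
    rcases List.mem_cons.1 hp with rfl | hp
    · exact ⟨_, by simp, h⟩
    · obtain ⟨R, hR, h'⟩ := ih hp
      exact ⟨R, by simp [hR], h'⟩

theorem exists_piece {L : List Piece} {P : List Rect} (h : List.Forall₂ IsPlacementOf L P)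
    {R : Rect} (hR : R ∈ P) : ∃ p ∈ L, IsPlacementOf p R := by
  induction h with
  | nil => simp at hR
  | cons h _ ih =>
    rcases List.mem_cons.1 hR with rfl | hR
    · exact ⟨_, by simp, h⟩
    · obtain ⟨p, hp, h'⟩ := ih hR
      exact ⟨p, by simp [hp], h'⟩

theorem totalArea_nonneg (L : List Piece) : 0 ≤ totalArea L := by
  apply List.sum_nonneg
  simp only [List.mem_map]
  rintro _ ⟨q, -, rfl⟩
  exact (mul_pos q.w_pos q.h_pos).le

theorem volume_iUnion_inner {L : List Piece} {P : List Rect} (h : IsPacking L P) :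
    volume (⋃ R ∈ P, R.inner) = ENNReal.ofReal (totalArea L) := by
  obtain ⟨h1, h2⟩ := h
  induction h1 with
  | nil => simp [totalArea]
  | @cons p R L P hpR _ ih =>
    rw [List.pairwise_cons] at h2
    have hm : MeasurableSet (⋃ S ∈ P, S.inner) :=
      MeasurableSet.biUnion P.finite_toSet.countable
        (fun S _ => measurableSet_Ioo.prod measurableSet_Ioo)
    have hd : Disjoint R.inner (⋃ S ∈ P, S.inner) := by
      simpa [Set.disjoint_iUnion_right] using h2.1
    have hu : (⋃ S ∈ R :: P, S.inner) = R.inner ∪ ⋃ S ∈ P, S.inner := by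
      ext x; simp
    have hvol : volume R.inner = ENNReal.ofReal (p.w * p.h) := by
      rw [Rect.inner, Measure.volume_eq_prod, Measure.prod_prod, Real.volume_Ioo, Real.volume_Ioo,
        ← ENNReal.ofReal_mul (by linarith [hpR.pos.1])]
      congr 1
      rcases hpR with ⟨h1, h2⟩ | ⟨h1, h2⟩ <;> rw [h1, h2] <;> ring
    rw [hu, measure_union hd hm, ih h2.2, hvol,
      ← ENNReal.ofReal_add (mul_pos p.w_pos p.h_pos).le (totalArea_nonneg L)]
    simp [totalArea]

theorem totalArea_le_boundingBoxArea {L : List Piece} {P : List Rect} (hL : L ≠ [])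
    (h : IsPacking L P) : totalArea L ≤ boundingBoxArea P := by
  obtain ⟨x₀, x₁, y₀, y₁, hA, hbox⟩ := exists_boundingBox P
  obtain ⟨p, hp⟩ := List.exists_mem_of_ne_nil L hL
  obtain ⟨R, hR, hpR⟩ := exists_placement h.1 hp
  have hsub : (⋃ R ∈ P, R.inner) ⊆ Set.Icc x₀ x₁ ×ˢ Set.Icc y₀ y₁ := by
    refine Set.iUnion₂_subset fun S hS => Set.prod_mono ?_ ?_
    · exact Set.Ioo_subset_Icc_self.trans (Set.Icc_subset_Icc (hbox S hS).1 (hbox S hS).2.1)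
    · exact Set.Ioo_subset_Icc_self.trans (Set.Icc_subset_Icc (hbox S hS).2.2.1 (hbox S hS).2.2.2)
  have hle := measure_mono (μ := volume) hsub
  have hb := hbox R hR
  have hx : 0 ≤ x₁ - x₀ := by linarith [hpR.pos.1]
  have hy : 0 ≤ y₁ - y₀ := by linarith [hpR.pos.2]
  rw [volume_iUnion_inner h, Measure.volume_eq_prod, Measure.prod_prod, Real.volume_Icc,
    Real.volume_Icc, ← ENNReal.ofReal_mul hx, ENNReal.ofReal_le_ofReal_iff (mul_nonneg hx hy)] at hle
  rwa [hA]

/-- In either orientation `p` forces both sides of the bounding box to be at least `p.w`, so it does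
not matter which side the height of `q` occupies. -/
theorem width_mul_height_le_boundingBoxArea {L : List Piece} {P : List Rect} (h : IsPacking L P)
    {p q : Piece} (hp : p ∈ L) (hq : q ∈ L) (hpw : p.w ≤ p.h) :
    p.w * q.h ≤ boundingBoxArea P := by
  obtain ⟨x₀, x₁, y₀, y₁, hA, hbox⟩ := exists_boundingBox P
  obtain ⟨R, hR, hpR⟩ := exists_placement h.1 hp
  obtain ⟨S, hS, hqS⟩ := exists_placement h.1 hq
  have hb := hbox R hR
  have hb' := hbox S hS
  have hRw : p.w ≤ R.w ∧ p.w ≤ R.h := by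
    rcases hpR with ⟨h1, h2⟩ | ⟨h1, h2⟩ <;> rw [h1, h2] <;> exact ⟨by linarith, by linarith⟩
  rw [hA]
  rcases hqS with ⟨h1, h2⟩ | ⟨h1, h2⟩
  · exact mul_le_mul (by linarith) (by linarith) q.h_pos.le (by linarith [p.w_pos])
  · rw [mul_comm]
    exact mul_le_mul (by linarith) (by linarith) p.w_pos.le (by linarith [q.h_pos])

theorem isPlacementOf_upright {p : Piece} {R : Rect} :
    IsPlacementOf p.upright R ↔ IsPlacementOf p R := by
  unfold IsPlacementOf Piece.upright
  split_ifs
  · rfl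
  · exact or_comm

theorem isPacking_map_upright {L : List Piece} {P : List Rect} :
    IsPacking (L.map Piece.upright) P ↔ IsPacking L P := by
  simp only [IsPacking, List.forall₂_map_left_iff, isPlacementOf_upright]

theorem Piece.upright_w_le_h (p : Piece) : p.upright.w ≤ p.upright.h := by
  unfold Piece.upright
  split_ifs with h
  · exact h
  · exact (not_le.1 h).le

theorem Piece.one_le_upright_w {p : Piece} (hp : 1 ≤ p.w ∧ 1 ≤ p.h) : 1 ≤ p.upright.w := by
  unfold Piece.upright
  split_ifs
  · exact hp.1
  · exact hp.2

/-! ### Total area and maximal height -/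

theorem totalArea_append (L L' : List Piece) :
    totalArea (L ++ L') = totalArea L + totalArea L' := by
  simp [totalArea]

theorem totalArea_mono {L L' : List Piece} (h : L <+: L') : totalArea L ≤ totalArea L' := by
  obtain ⟨M, rfl⟩ := h
  rw [totalArea_append]
  linarith [totalArea_nonneg M]

theorem maxHeight_nonneg (L : List Piece) : 0 ≤ maxHeight L := by
  cases L <;> simp [maxHeight, Piece.h_pos, le_of_lt]

theorem le_maxHeight {L : List Piece} {p : Piece} (hp : p ∈ L) : p.h ≤ maxHeight L := by
  induction L with
  | nil => simp at hp
  | cons q L ih =>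
    rcases List.mem_cons.1 hp with rfl | hp
    · simp [maxHeight]
    · exact (ih hp).trans (by simp [maxHeight])

theorem exists_maxHeight {L : List Piece} (hL : L ≠ []) : ∃ p ∈ L, maxHeight L = p.h := by
  induction L with
  | nil => exact absurd rfl hL
  | cons q L ih =>
    have h : maxHeight (q :: L) = max q.h (maxHeight L) := by simp [maxHeight]
    rcases max_choice q.h (maxHeight L) with h' | h'
    · exact ⟨q, by simp, by rw [h, h']⟩
    · rcases eq_or_ne L [] with rfl | hne
      · refine ⟨q, by simp, ?_⟩
        simp [maxHeight, q.h_pos.le]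
      · obtain ⟨p, hp, hpe⟩ := ih hne
        exact ⟨p, by simp [hp], by rw [h, h', hpe]⟩

theorem maxHeight_mono {L L' : List Piece} (h : L <+: L') : maxHeight L ≤ maxHeight L' := by
  rcases eq_or_ne L [] with rfl | hne
  · exact maxHeight_nonneg _
  · obtain ⟨p, hp, hpe⟩ := exists_maxHeight hne
    rw [hpe]
    exact le_maxHeight (h.subset hp)

theorem exists_totalArea_le {L : List Piece} (hL : L ≠ []) :
    ∃ p ∈ L, totalArea L ≤ L.length * (p.w * maxHeight L) := by
  obtain ⟨p, hp, hmax⟩ := Set.exists_max_image {p | p ∈ L} Piece.w L.finite_toSet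
    (List.exists_mem_of_ne_nil L hL)
  refine ⟨p, hp, ?_⟩
  have := List.sum_le_card_nsmul (L.map fun q => q.w * q.h) (p.w * maxHeight L) (by
    simp only [List.mem_map]
    rintro _ ⟨q, hq, rfl⟩
    exact mul_le_mul (hmax q hq) (le_maxHeight hq) q.h_pos.le p.w_pos.le)
  simpa [totalArea] using this

/-! ### The threshold -/

theorem threshold_append (L L' : List Piece) : ∀ n ≤ L.length,
    threshold (L ++ L') n = threshold L n := by
  intro n
  induction n with
  | zero => intro _; rfl
  | succ n ih =>
    intro hn
    rw [threshold, threshold, ih (by omega), List.take_append_of_le_length hn]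

theorem threshold_concat (L : List Piece) (p : Piece) :
    threshold (L ++ [p]) (L ++ [p]).length =
      max (threshold L L.length) (preThreshold (L ++ [p])) := by
  rw [List.length_append, List.length_singleton, threshold, threshold_append L [p] _ le_rfl,
    List.take_of_length_le (by simp)]

theorem preThreshold_le_threshold {L : List Piece} (hL : L ≠ []) :
    preThreshold L ≤ threshold L L.length := by
  rw [← List.dropLast_append_getLast hL, threshold_concat]
  exact le_max_right _ _

theorem threshold_le {L : List Piece} (hL : L ≠ []) {c : ℝ} (hc : 0 ≤ c)
    (h : ∀ L', L' <+: L → L' ≠ [] → preThreshold L' ≤ c) (n : ℕ) : threshold L n ≤ c := by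
  induction n with
  | zero => exact hc
  | succ n ih => exact max_le ih (h _ (List.take_prefix _ _) (by simpa using hL))

theorem seven_mul_maxHeight_le_preThreshold (L : List Piece) :
    7 * maxHeight L ≤ preThreshold L := by
  have h0 := maxHeight_nonneg L
  unfold preThreshold
  split_ifs
  · linarith [Real.rpow_nonneg (totalArea_nonneg L) (3 / 4)]
  · linarith [mul_nonneg h0 (Real.sqrt_nonneg L.length)]

/-! ### The invariant of the scheme -/

/-- Either a piece wider than half the box `k` forced the use of that box, or a piece overflowed
the box `k - 1`, at a time when all earlier boxes were filled at most up to the threshold. -/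
def BoxJustified (L : List Piece) (s : State) (k : ℤ) : Prop :=
  (∃ p ∈ L, (2 : ℝ) ^ k < 2 * p.w) ∨
  ∃ L', L' <+: L ∧ L' ≠ [] ∧
    threshold L' L'.length * 2 ^ (k - 1) < 4 * totalArea L' + 5 * maxHeight L' * 2 ^ (k - 1) ∧
    ∀ R ∈ s.placed, R.y + R.h ≤ threshold L' L'.length ∨ InShelves (2 ^ k) R 0 (s.shelves k)

/-- What is true of the state `s` of the scheme after the stream `L`. -/
structure Invariant (L : List Piece) (s : State) : Prop where
  seen : s.seen = L
  active : L ≠ [] → ∃ k, s.active = some k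
  empty : ∀ l, (∀ i, s.active = some i → i < l) → s.shelves l = []
  ok : ∀ l, ShelvesOK l (s.shelves l)
  lev : ∀ l, ∀ t ∈ s.shelves l, (2 : ℝ) ^ (t.lev - 1) ≤ maxHeight L
  area : ∀ l, shelvesArea (s.shelves l) ≤ totalArea L
  packing : IsPacking L s.placed
  inShelves : ∀ R ∈ s.placed, ∃ l, InShelves (2 ^ l) R 0 (s.shelves l)
  top_le : ∀ R ∈ s.placed, R.y + R.h ≤ threshold L L.length
  justified : ∀ k, s.active = some k → BoxJustified L s k

theorem ShelvesOK.nil (k : ℤ) : ShelvesOK k [] := ⟨by simp, by simp, by simp⟩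

theorem invariant_init : Invariant [] State.init where
  seen := rfl
  active := fun h => absurd rfl h
  empty := fun _ _ => rfl
  ok := fun l => ShelvesOK.nil l
  lev := by simp [State.init]
  area := by simp [State.init, shelvesArea, totalArea]
  packing := ⟨List.Forall₂.nil, List.Pairwise.nil⟩
  inShelves := by simp [State.init]
  top_le := by simp [State.init]
  justified := by simp [State.init]

theorem le_threshold_concat (L : List Piece) (p : Piece) :
    p.h ≤ threshold (L ++ [p]) (L ++ [p]).length := by
  have h1 := preThreshold_le_threshold (L := L ++ [p]) (by simp)
  have h2 := seven_mul_maxHeight_le_preThreshold (L ++ [p])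
  have h3 : p.h ≤ maxHeight (L ++ [p]) := le_maxHeight (by simp)
  linarith [p.h_pos]

theorem two_zpow_level_lt (p : Piece) : (2 : ℝ) ^ level p.w < 2 * p.w := by
  have := two_zpow_level_sub_one_lt p.w_pos
  rw [two_zpow_sub_one] at this
  linarith

/-- The active index never decreases, and each change is due to a wide piece or to an overflow. The
chosen box always has room below `t`. -/
theorem Invariant.target_spec {L : List Piece} {s : State} (hs : Invariant L s) {p : Piece} {t : ℝ}
    (ht : p.h ≤ t) :
    p.w ≤ 2 ^ s.target t p ∧ (∀ i, s.active = some i → i ≤ s.target t p) ∧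
    (nfs (s.target t p) p 0 (s.shelves (s.target t p))).2.2 + p.h ≤ t ∧
    (s.active = some (s.target t p) ∨ (2 : ℝ) ^ s.target t p < 2 * p.w ∨
      ∃ i, s.active = some i ∧ s.target t p = i + 1 ∧
        t < (nfs i p 0 (s.shelves i)).2.2 + p.h) := by
  -- Boxes beyond the active one are empty, so there the piece stands on the floor and `p.h ≤ t`
  -- suffices.
  have hnew : ∀ l, (∀ i, s.active = some i → i < l) →
      (nfs l p 0 (s.shelves l)).2.2 + p.h ≤ t := by
    intro l hl
    rw [hs.empty l hl]
    simpa [nfs] using ht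
  have hlev := le_two_zpow_level p.w
  unfold State.target
  rcases hact : s.active with _ | i
  · exact ⟨hlev, by simp, hnew _ (by simp [hact]), Or.inr (Or.inl (two_zpow_level_lt p))⟩
  · simp only [Option.some.injEq, forall_eq']
    split_ifs with h1 h2
    · have hlt : i < level p.w := by
        have := h1.trans_le hlev
        rwa [zpow_lt_zpow_iff_right₀ (by norm_num)] at this
      exact ⟨hlev, hlt.le, hnew _ (by simp [hact, hlt]), Or.inr (Or.inl (two_zpow_level_lt p))⟩
    · refine ⟨?_, by omega, hnew _ (by simp [hact]), Or.inr (Or.inr ⟨i, rfl, rfl, h2⟩)⟩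
      rw [zpow_add_one₀ (by norm_num)]
      linarith [p.w_pos]
    · exact ⟨not_lt.1 h1, le_rfl, not_lt.1 h2, Or.inl rfl⟩

theorem InShelves.disjoint_of_lt {l k : ℤ} (hlk : l < k) {R S : Rect} {ss ts : List Shelf}
    (hss : ShelvesOK l ss) (hR : InShelves (2 ^ l) R 0 ss) (hS : InShelves (2 ^ k) S 0 ts) :
    Disjoint R.inner S.inner := by
  apply disjoint_inner_of_right_le
  have h1 := hR.right_le hss.used_le
  have h2 := hS.left_le
  have h3 : (2 : ℝ) ^ (l + 1) ≤ 2 ^ k := zpow_le_zpow_right₀ (by norm_num) hlk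
  rw [zpow_add_one₀ (by norm_num)] at h3
  linarith

theorem Invariant.step {L : List Piece} {s : State} (hs : Invariant L s) (p : Piece) :
    Invariant (L ++ [p]) (s.step (fun L => threshold L L.length) p) := by
  obtain ⟨hw, hact, htop, hcase⟩ := hs.target_spec (le_threshold_concat L p)
  rw [← hs.seen] at hw hact htop hcase
  unfold State.step
  simp only
  set t := threshold (s.seen ++ [p]) (s.seen ++ [p]).length with ht
  set k := s.target t p with hk
  set r := nfs k p 0 (s.shelves k) with hr
  set R' : Rect := ⟨2 ^ k + r.2.1, r.2.2, p.w, p.h⟩ with hR'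
  rw [hs.seen] at ht
  have hself : InShelves (2 ^ k) R' 0 (Function.update s.shelves k r.1 k) := by
    rw [Function.update_self]
    exact inShelves_nfs_self _ (hs.ok k).used_nonneg 0
  have hold : ∀ l R, InShelves (2 ^ l) R 0 (s.shelves l) →
      InShelves (2 ^ l) R 0 (Function.update s.shelves k r.1 l) := by
    intro l R hR
    rcases eq_or_ne l k with rfl | hne
    · rw [Function.update_self]; exact hR.nfs
    · rwa [Function.update_of_ne hne]
  have hok : ∀ l, ShelvesOK l (Function.update s.shelves k r.1 l) := by
    intro l
    rcases eq_or_ne l k with rfl | hne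
    · rw [Function.update_self]; exact (hs.ok _).nfs hw 0
    · rw [Function.update_of_ne hne]; exact hs.ok l
  have hpre : L <+: L ++ [p] := List.prefix_append _ _
  have htL : threshold L L.length ≤ t := by
    rw [ht, threshold_concat]; exact le_max_left _ _
  have hH : p.h ≤ maxHeight (L ++ [p]) := le_maxHeight (by simp)
  refine ⟨by rw [hs.seen], fun _ => ⟨k, rfl⟩, ?_, hok, ?_, ?_, ⟨?_, ?_⟩, ?_, ?_, ?_⟩
  · intro l hl
    have hkl := hl k rfl
    simp only [Function.update_of_ne hkl.ne']
    exact hs.empty l fun i hi => (hact i hi).trans_lt hkl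
  · intro l u hu
    have hmono := maxHeight_mono hpre
    rcases eq_or_ne l k with rfl | hne
    · simp only [Function.update_self] at hu
      rcases mem_nfs _ _ u hu with ⟨rfl, -⟩ | ⟨v, hv, hvu, -⟩
      · exact (two_zpow_level_sub_one_lt p.h_pos).le.trans hH
      · rw [← hvu]; exact (hs.lev _ v hv).trans hmono
    · simp only [Function.update_of_ne hne] at hu
      exact (hs.lev l u hu).trans hmono
  · intro l
    have h1 : totalArea (L ++ [p]) = totalArea L + p.w * p.h := by simp [totalArea]
    have h2 := mul_pos p.w_pos p.h_pos
    have h3 := hs.area l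
    rcases eq_or_ne l k with rfl | hne
    · simp only [Function.update_self]
      have := shelvesArea_nfs_le (k := k) (p := p) (s.shelves k) 0
      linarith
    · simp only [Function.update_of_ne hne]
      linarith
  · exact List.rel_append hs.packing.1 (List.Forall₂.cons (Or.inl ⟨rfl, rfl⟩) List.Forall₂.nil)
  · refine List.pairwise_append.2 ⟨hs.packing.2, List.pairwise_singleton _ _, ?_⟩
    intro R hR S hS
    rw [List.mem_singleton.1 hS]
    obtain ⟨l, hl⟩ := hs.inShelves R hR
    rcases lt_trichotomy l k with hlt | rfl | hlt
    · exact hl.disjoint_of_lt hlt (hs.ok l) hself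
    · exact hl.disjoint_nfs
    · exact (hself.disjoint_of_lt hlt (hok k) hl).symm
  · intro R hR
    rcases List.mem_append.1 hR with hR | hR
    · obtain ⟨l, hl⟩ := hs.inShelves R hR
      exact ⟨l, hold l R hl⟩
    · rw [List.mem_singleton.1 hR]
      exact ⟨k, hself⟩
  · intro R hR
    rcases List.mem_append.1 hR with hR | hR
    · exact (hs.top_le R hR).trans (htL.trans_eq ht)
    · rw [List.mem_singleton.1 hR]
      exact ht ▸ htop
  · intro k' hk'
    obtain rfl : k = k' := Option.some.inj hk'
    rcases hcase with hc | hc | ⟨i, hi, hki, hlt⟩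
    -- The box stays active: its old justification survives, because the new piece lies in box `k`.
    · rcases hs.justified k hc with ⟨q, hq, h⟩ | ⟨L', hL', hne, h1, h2⟩
      · exact Or.inl ⟨q, by simp [hq], h⟩
      · refine Or.inr ⟨L', hL'.trans hpre, hne, h1, fun R hR => ?_⟩
        rcases List.mem_append.1 hR with hR | hR
        · exact (h2 R hR).imp_right (hold k R)
        · rw [List.mem_singleton.1 hR]
          exact Or.inr hself
    · exact Or.inl ⟨p, by simp, hc⟩
    -- An overflow starts a new justification at the present moment. All older pieces lie below `t`
    -- because the threshold is monotone.
    · refine Or.inr ⟨L ++ [p], List.prefix_rfl, by simp, ?_, fun R hR => ?_⟩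
      · rw [← ht, hki, add_sub_cancel_right]
        have h1 := nfs_y_le (k := i) (p := p) (s.shelves i) 0
        have h2 := (hs.ok i).height_le (maxHeight_nonneg L) (hs.lev i)
        have h3 := hs.area i
        have h4 := totalArea_mono hpre
        have h5 := maxHeight_mono hpre
        have h6 := two_zpow_pos i
        -- The shelves account for 4 times the maximal height and the overflowing piece for one
        -- more, hence the 5 in `BoxJustified`.
        have h7 : t * 2 ^ i < (shelvesHeight (s.shelves i) + maxHeight (L ++ [p])) * 2 ^ i :=
          mul_lt_mul_of_pos_right (by linarith) h6
        have h8 := mul_le_mul_of_nonneg_right h5 h6.le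
        linarith
      · rcases List.mem_append.1 hR with hR | hR
        · exact Or.inl ((hs.top_le R hR).trans (htL.trans_eq ht))
        · rw [List.mem_singleton.1 hR]
          exact Or.inr hself

theorem invariant_foldl (L : List Piece) :
    Invariant L (L.foldl (State.step fun L => threshold L L.length) State.init) := by
  induction L using List.reverseRecOn with
  | nil => exact invariant_init
  | append_singleton L p ih =>
    rw [List.foldl_append, List.foldl_cons, List.foldl_nil]
    exact ih.step p

theorem isPacking_dynBoxRotMin (L : List Piece) : IsPacking L (dynBoxRotMin L) :=
  isPacking_map_upright.1 (invariant_foldl _).packing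

theorem placed_prefix_foldl (T : List Piece → ℝ) (L : List Piece) :
    ∀ s : State, s.placed <+: (L.foldl (State.step T) s).placed := by
  induction L with
  | nil => intro s; exact List.prefix_rfl
  | cons p L ih => intro s; exact List.IsPrefix.trans (l₂ := (s.step T p).placed) (List.prefix_append _ _) (ih _)

theorem isOnlineAlgorithm_dynBoxRotMin (𝓛 : Set (List Piece)) :
    IsOnlineAlgorithm 𝓛 dynBoxRotMin := by
  refine ⟨fun L _ => isPacking_dynBoxRotMin L, fun L L' => ?_⟩
  unfold dynBoxRotMin dynBoxRot dynBox
  rw [List.map_append, List.foldl_append]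
  exact placed_prefix_foldl _ _ _

/-! ### The area used -/

/-- The infimum is over a non-empty set: the algorithm itself supplies a packing. -/
theorem le_opt {L : List Piece} {c : ℝ} (h : ∀ P, IsPacking L P → c ≤ boundingBoxArea P) :
    c ≤ opt L :=
  le_csInf ⟨_, _, isPacking_dynBoxRotMin L, rfl⟩ (by rintro _ ⟨P, hP, rfl⟩; exact h P hP)

theorem opt_map_upright (L : List Piece) : opt (L.map Piece.upright) = opt L := by
  simp only [opt, isPacking_map_upright]

/-- If all pieces are placed below height `X`, and the active box is `k`, then the bounding box
has area at most `2 ^ (k + 1) * X`. -/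
theorem Invariant.boundingBoxArea_le {L : List Piece} {s : State} (hs : Invariant L s) {k : ℤ}
    (hk : s.active = some k) (hL : L ≠ []) {X : ℝ} (hX : ∀ R ∈ s.placed, R.y + R.h ≤ X) :
    boundingBoxArea s.placed ≤ 2 * 2 ^ k * X := by
  have hpos : ∀ R ∈ s.placed, 0 < R.w ∧ 0 < R.h := by
    intro R hR
    obtain ⟨q, -, hq⟩ := exists_piece hs.packing.1 hR
    exact hq.pos
  refine OnlinePacking.boundingBoxArea_le ?_ ?_ (fun R hR => (hpos R hR).1.le) ?_ ?_
    (fun R hR => (hpos R hR).2.le) hX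
  · intro h
    have := hs.packing.1.length_eq
    rw [h] at this
    exact hL (List.length_eq_zero_iff.1 this)
  · intro R hR
    obtain ⟨l, hl⟩ := hs.inShelves R hR
    exact (two_zpow_pos l).le.trans hl.left_le
  · intro R hR
    obtain ⟨l, hl⟩ := hs.inShelves R hR
    have hlk : l ≤ k := by
      by_contra hlt
      rw [hs.empty l (fun i hi => by rw [hk] at hi; cases hi; omega)] at hl
      exact hl
    have h1 := hl.right_le (hs.ok l).used_le
    have h2 : (2 : ℝ) ^ l ≤ 2 ^ k := zpow_le_zpow_right₀ (by norm_num) hlk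
    linarith
  · intro R hR
    obtain ⟨l, hl⟩ := hs.inShelves R hR
    exact hl.le_y

/-- Replaces real exponents by polynomials in `r`; the test Σ < j² becomes r < √j. -/
theorem exists_fourth_root {S : ℝ} (hS : 0 ≤ S) :
    ∃ r : ℝ, 0 ≤ r ∧ S ^ (3 / 4 : ℝ) = r ^ 3 ∧ S = r ^ 4 := by
  refine ⟨S ^ (1 / 4 : ℝ), Real.rpow_nonneg hS _, ?_, ?_⟩ <;>
    rw [← Real.rpow_natCast, ← Real.rpow_mul hS] <;> norm_num

/-- The area in the case where the active box was entered because of a wide piece. -/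
theorem width_mul_threshold_le {L : List Piece} {p : Piece} (hL : L ≠ []) {q n O μ H : ℝ}
    (hq : 0 ≤ q) (hO : O = q ^ 4) (hμ : 1 ≤ μ) (hμm : ∀ x, x ≤ √n → x ≤ q → x ≤ μ)
    (hn : (L.length : ℝ) ≤ n) (hS : totalArea L ≤ O) (hH : maxHeight L ≤ H)
    (hwH : p.w * H ≤ O) (hww : p.w ^ 2 ≤ O) (j : ℕ) :
    p.w * threshold L j ≤ 8 * μ * O := by
  have hO0 : 0 ≤ O := by rw [hO]; positivity
  have hw := p.w_pos
  -- This form bounds the running maximum by one constant, valid for the preliminary threshold of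
  -- every prefix. The 8 is 1 for the main term plus 7 for the term 7H.
  suffices h : threshold L j ≤ 8 * μ * O / p.w by
    rwa [le_div_iff₀ hw, mul_comm] at h
  refine threshold_le hL (by positivity) (fun L' hL' _ => ?_) j
  rw [le_div_iff₀ hw, mul_comm]
  have hm : √(L'.length : ℝ) ≤ √n :=
    Real.sqrt_le_sqrt ((Nat.cast_le.2 hL'.length_le).trans hn)
  have hm0 := Real.sqrt_nonneg (L'.length : ℝ)
  have hm2 := Real.sq_sqrt (Nat.cast_nonneg (α := ℝ) L'.length)
  have hH' : p.w * maxHeight L' ≤ O :=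
    (mul_le_mul_of_nonneg_left ((maxHeight_mono hL').trans hH) hw.le).trans hwH
  have hμO : O ≤ μ * O := le_mul_of_one_le_left hO0 hμ
  obtain ⟨r, hr, hr3, hr4⟩ := exists_fourth_root (totalArea_nonneg L')
  have hrq : r ≤ q := by
    have := (totalArea_mono hL').trans hS
    rw [hr4, hO] at this
    exact le_of_pow_le_pow_left₀ (by norm_num) hq this
  have hwq : p.w ≤ q ^ 2 := by
    rw [hO] at hww
    exact le_of_pow_le_pow_left₀ (n := 2) (by norm_num) (by positivity) (by linarith)
  unfold preThreshold
  rw [hr3]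
  split_ifs with hc
  · have hrm : r ≤ √(L'.length : ℝ) := by
      rw [hr4, ← hm2] at hc
      exact (lt_of_pow_lt_pow_left₀ 4 hm0 (by linarith)).le
    have hrμ := hμm r (hrm.trans hm) hrq
    have h1 : p.w * r ^ 3 ≤ μ * O := by
      -- Only one factor `r` needs the sharper bound μ; the width and the other two factors give √O
      -- each.
      calc p.w * r ^ 3 = p.w * r ^ 2 * r := by ring
        _ ≤ q ^ 2 * q ^ 2 * μ := by gcongr
        _ = μ * O := by rw [hO]; ring
    linarith
  · have hmr : √(L'.length : ℝ) ≤ r := by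
      rw [not_lt, hr4, ← hm2] at hc
      exact le_of_pow_le_pow_left₀ (n := 4) (by norm_num) hr (by linarith)
    have hmμ := hμm _ hm (hmr.trans hrq)
    have h1 : p.w * maxHeight L' * √(L'.length : ℝ) ≤ O * μ := by gcongr
    linarith

/-- The width of the active box in the case where it was entered because of an overflow. -/
theorem width_mul_maxHeight_le {L L' : List Piece} (hL' : L' <+: L) (hne : L' ≠ [])
    {q n O μ H b : ℝ} (hq : 0 ≤ q) (hO : O = q ^ 4) (hμ : 1 ≤ μ)
    (hμm : ∀ x, x ≤ √n → x ≤ q → x ≤ μ)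
    (hn : (L.length : ℝ) ≤ n) (hS : totalArea L ≤ O) (hH0 : 0 ≤ H) (hHO : H ≤ O)
    (hwH : ∀ p ∈ L, p.w * H ≤ O) (hb : 0 < b)
    (hover : threshold L' L'.length * b < 4 * totalArea L' + 5 * maxHeight L' * b) :
    b * H ≤ 4 * μ * O := by
  have hO0 : 0 ≤ O := by rw [hO]; positivity
  have hover' := (mul_le_mul_of_nonneg_right (preThreshold_le_threshold hne) hb.le).trans_lt hover
  have hm : √(L'.length : ℝ) ≤ √n :=
    Real.sqrt_le_sqrt ((Nat.cast_le.2 hL'.length_le).trans hn)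
  have hm1 : 0 < √(L'.length : ℝ) :=
    Real.sqrt_pos.2 (Nat.cast_pos.2 (List.length_pos_of_ne_nil hne))
  have hm2 := Real.sq_sqrt (Nat.cast_nonneg (α := ℝ) L'.length)
  have hH' : 0 < maxHeight L' := by
    obtain ⟨p, -, hp⟩ := exists_maxHeight hne
    rw [hp]; exact p.h_pos
  obtain ⟨r, hr, hr3, hr4⟩ := exists_fourth_root (totalArea_nonneg L')
  have hrq : r ≤ q := by
    have := (totalArea_mono hL').trans hS
    rw [hr4, hO] at this
    exact le_of_pow_le_pow_left₀ (by norm_num) hq this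
  -- The threshold contains 7H' and the overflow bound only 5H', so both terms drop out below and
  -- the main term alone bounds `b`.
  have hbH : 0 < maxHeight L' * b := by positivity
  unfold preThreshold at hover'
  rw [hr3] at hover'
  split_ifs at hover' with hc
  · have hrm : r ≤ √(L'.length : ℝ) := by
      rw [hr4, ← hm2] at hc
      exact (lt_of_pow_lt_pow_left₀ 4 hm1.le (by linarith)).le
    have hrμ := hμm r (hrm.trans hm) hrq
    have hbr : b < 4 * r := by
      rw [hr4] at hover'
      have : r ^ 3 * b < r ^ 3 * (4 * r) := by linarith
      exact lt_of_mul_lt_mul_left this (by positivity)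
    exact mul_le_mul (by linarith) hHO hH0 (by linarith)
  · have hmr : √(L'.length : ℝ) ≤ r := by
      rw [not_lt, hr4, ← hm2] at hc
      exact le_of_pow_le_pow_left₀ (n := 4) (by norm_num) hr (by linarith)
    have hmμ := hμm _ hm (hmr.trans hrq)
    obtain ⟨p, hp, hpS⟩ := exists_totalArea_le hne
    -- Here `p` is the widest piece of `L'`, so Σ' ≤ j·w·H'; cancelling H'√j from H'√j·b < 4Σ'
    -- leaves this bound.
    have hbw : b ≤ 4 * √(L'.length : ℝ) * p.w := by
      have : (maxHeight L' * √(L'.length : ℝ)) * b ≤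
          (maxHeight L' * √(L'.length : ℝ)) * (4 * √(L'.length : ℝ) * p.w) := by
        have : (maxHeight L' * √(L'.length : ℝ)) * (4 * √(L'.length : ℝ) * p.w) =
            4 * (√(L'.length : ℝ) ^ 2 * (p.w * maxHeight L')) := by ring
        rw [this, hm2]
        linarith
      exact le_of_mul_le_mul_left this (by positivity)
    have h1 := hwH p (hL'.subset hp)
    have hpw := p.w_pos.le
    calc b * H ≤ 4 * √(L'.length : ℝ) * p.w * H := by gcongr
      _ = 4 * √(L'.length : ℝ) * (p.w * H) := by ring
      _ ≤ 4 * μ * O :=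
        mul_le_mul (by linarith) h1 (mul_nonneg hpw hH0) (by linarith)

theorem hasAbsoluteCompetitiveRatio_dynBoxRotMin :
    HasAbsoluteCompetitiveRatio longStreams dynBoxRotMin
      (fun L => 96 * min (√L.length) (opt L ^ (1 / 4 : ℝ))) := by
  rintro L₀ ⟨hne, hone⟩
  simp only
  set L := L₀.map Piece.upright with hLdef
  have hL : L ≠ [] := by simpa [hLdef] using hne
  have hlen : L₀.length = L.length := by simp [hLdef]
  have hup : ∀ p ∈ L, p.w ≤ p.h ∧ 1 ≤ p.w := by
    simp only [hLdef, List.mem_map]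
    rintro _ ⟨p, hp, rfl⟩
    exact ⟨p.upright_w_le_h, Piece.one_le_upright_w (hone p hp)⟩
  have hs := invariant_foldl L
  have halg : dynBoxRotMin L₀ =
      (L.foldl (State.step fun L => threshold L L.length) State.init).placed := rfl
  rw [halg, ← opt_map_upright, hlen, ← hLdef]
  set s := L.foldl (State.step fun L => threshold L L.length) State.init
  set O := opt L with hOdef
  set H := maxHeight L with hHdef
  have hS : totalArea L ≤ O := le_opt fun P hP => totalArea_le_boundingBoxArea hL hP
  have hwH : ∀ p ∈ L, p.w * H ≤ O := by
    intro p hp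
    obtain ⟨q, hq, hqH⟩ := exists_maxHeight hL
    rw [hHdef, hqH]
    exact le_opt fun P hP => width_mul_height_le_boundingBoxArea hP hp hq (hup p hp).1
  obtain ⟨p₀, hp₀⟩ := List.exists_mem_of_ne_nil L hL
  have hH1 : 1 ≤ H := ((hup p₀ hp₀).2.trans (hup p₀ hp₀).1).trans (le_maxHeight hp₀)
  -- The edge bound enters here: a width of at least 1 turns w·H ≤ O into H ≤ O.
  have hHO : H ≤ O := (le_mul_of_one_le_left (by linarith) (hup p₀ hp₀).2).trans (hwH p₀ hp₀)
  have hO1 : 1 ≤ O := hH1.trans hHO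
  set q := O ^ (1 / 4 : ℝ) with hqdef
  have hq1 : 1 ≤ q := Real.one_le_rpow hO1 (by norm_num)
  have hOq : O = q ^ 4 := by
    rw [hqdef, ← Real.rpow_natCast, ← Real.rpow_mul (by linarith)]; norm_num
  set μ := min (√(L.length : ℝ)) q
  have hμ : 1 ≤ μ := by
    refine le_min ?_ hq1
    rw [Real.one_le_sqrt]
    exact_mod_cast List.length_pos_of_ne_nil hL
  have hμO : O ≤ μ * O := le_mul_of_one_le_left (by linarith) hμ
  have hμm : ∀ x, x ≤ √(L.length : ℝ) → x ≤ q → x ≤ μ := fun x => le_min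
  obtain ⟨k, hk⟩ := hs.active hL
  rcases hs.justified k hk with ⟨p, hp, hpk⟩ | ⟨L', hL', hne', hover, htop⟩
  · have hww : p.w ^ 2 ≤ O := by
      rw [sq]
      refine le_trans ?_ (hwH p hp)
      exact mul_le_mul_of_nonneg_left ((hup p hp).1.trans (le_maxHeight hp)) p.w_pos.le
    have h1 := width_mul_threshold_le hL (by linarith) hOq hμ hμm le_rfl hS le_rfl (hwH p hp) hww
      L.length
    have h2 := hs.boundingBoxArea_le hk hL hs.top_le
    have h3 : 0 ≤ threshold L L.length := by
      have := preThreshold_le_threshold hL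
      have := seven_mul_maxHeight_le_preThreshold L
      linarith
    have h4 := mul_le_mul_of_nonneg_right hpk.le h3
    -- The cost is at most 2·2^k·T ≤ 4wT ≤ 32μO.
    nlinarith
  · have hb := two_zpow_pos (k - 1)
    have hbH := width_mul_maxHeight_le hL' hne' (by linarith) hOq hμ hμm le_rfl hS (by linarith)
      hHO hwH hb hover
    have hkb : (2 : ℝ) ^ k = 2 * 2 ^ (k - 1) := by rw [two_zpow_sub_one]; ring
    set b := (2 : ℝ) ^ (k - 1)
    -- One height bound for both kinds of pieces: those below the threshold at the overflow, and
    -- those in box `k`, whose width 2b makes its shelf bound even smaller.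
    have hX : ∀ R ∈ s.placed, R.y + R.h ≤ (4 * totalArea L + 5 * H * b) / b := by
      intro R hR
      rw [le_div_iff₀ hb]
      rcases htop R hR with h | h
      · have h1 := totalArea_mono hL'
        have h2 := mul_le_mul_of_nonneg_right (maxHeight_mono hL') hb.le
        have h3 := mul_le_mul_of_nonneg_right h hb.le
        linarith
      · have h1 := h.top_le
        have h2 := (hs.ok k).height_le (maxHeight_nonneg L) (hs.lev k)
        have h3 := hs.area k
        have h4 := mul_le_mul_of_nonneg_right h1 hb.le
        have h5 := totalArea_nonneg L
        rw [hkb] at h2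
        have h6 : 0 ≤ H * b := by positivity
        linarith
    have hA := hs.boundingBoxArea_le hk hL hX
    -- With Σ ≤ O ≤ μO and bH ≤ 4μO this is at most (16 + 80)μO, the source of the constant 96.
    have hE : 2 * 2 ^ k * ((4 * totalArea L + 5 * H * b) / b) =
        16 * totalArea L + 20 * (b * H) := by
      rw [hkb]; field_simp; ring
    rw [hE] at hA
    linarith

end OnlinePacking

end

theorem mainTheorem6 :
    OnlinePacking.IsOnlineAlgorithm OnlinePacking.longStreams OnlinePacking.dynBoxRotMin ∧
      ∃ C : ℝ, 0 < C ∧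
        OnlinePacking.HasAbsoluteCompetitiveRatio OnlinePacking.longStreams
          OnlinePacking.dynBoxRotMin
          (fun L => C * min (Real.sqrt L.length) (OnlinePacking.opt L ^ (1 / 4 : ℝ))) :=
  ⟨OnlinePacking.isOnlineAlgorithm_dynBoxRotMin _, 96, by norm_num,
    OnlinePacking.hasAbsoluteCompetitiveRatio_dynBoxRotMin⟩
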